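/- Let $M=(\mathcal S,\mathcal A,P,r)$ be a finite Markov decision process with transition function $P(y\mid x,a)$ and deterministic real rewards $r(x,a)$. For a stationary policy $\pi:\mathcal S\to\mathcal A$ and an initial state $x$ let $\rho^\pi(x)=\limsup_{n}\frac1n\,\mathbb E_{\pi}\big[\sum_{t=1}^{n}r(x_t,\pi(x_t))\,\big|\,x_1=x\big]$, and let $\rho^*=\max_{\pi,x}\rho^\pi(x)$ be the optimal average reward. A learner interacts with $M$ for $T$ rounds. The rounds are divided into $m$ phases, phase $k$ being $t_k\le t\le t_{k+1}-1$, with $1=t_1\le t_2\le\dots\le t_{m+1}=T+1$; $m$ may be random, and the $t_k$ are stopping times for a filtration $(\mathcal F_t)$ to which the states $x_t$ and the actions $a_t$ are adapted. In phase $k$ the learner plays a policy $\pi_k:\mathcal S\to\mathcal A$, so $a_t=\pi_k(x_t)$, and $\mathbb P(x_{t+1}=y\mid\mathcal F_t)=P(y\mid x_t,a_t)$. The regret is $\mathrm{Reg}_T=\sum_{t=1}^T(\rho^*-r(x_t,a_t))$. At the start of phase $k$ the learner has a reference transition function $\widehat P_k$, finitely many functions $w_{k,i}:\mathcal S\to\mathbb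 R$ and widths $b_{k,i}(x,a)\ge0$ ($i\in\mathcal I$), which define the confidence set $$\mathcal P_k=\Big\{p \text{ a transition function}:\ \sum_{y}w_{k,i}(y)\,|p(y\mid x,a)-\widehat P_k(y\mid x,a)|\le b_{k,i}(x,a)\ \ \forall i,x,a\Big\}.$$ For $\beta:\mathcal S\to\mathbb R$ let $\mathrm{CB}_k^\beta(x,a)\in[0,\infty]$ be the optimal value of $$\min_{c\in\mathbb R,\ \mu\ge0}\ \sum_i b_{k,i}(x,a)\mu_i\quad\text{subject to}\quad \sum_i w_{k,i}(y)\mu_i\ge|\beta(y)+c|\ \ \forall y\in\mathcal S .$$ On the event $\mathcal E=\bigcap_{k=1}^m\{P\in\mathcal P_k\}$, suppose the following for every $k\le m$. * $(\beta_k,\rho_k)$ is an optimal solution of the problem of minimizing $\rho$ over $(\beta,\rho)$ subject to $\beta(x)+\rho\ge r(x,a)+\mathrm{CB}_k^\beta(x,a)+\sum_y\widehat P_k(y\mid x,a)\beta(y)$ for all $x,a$. (Everywhere, $\beta_k$ is measurable with respect to $\mathcal F_{t_k}$.) * With $\mathrm{CB}_k=\mathrm{CB}_k^{\beta_k}$,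 the policy $\pi_k$ satisfies the optimality equation $\beta_k(x)+\rho_k=r(x,\pi_k(x))+\mathrm{CB}_k(x,\pi_k(x))+\sum_y\widehat P_k(y\mid x,\pi_k(x))\beta_k(y)$ at the states $x$ visited in phase $k$. * $\mathrm{sp}(\beta_k)=\max_x\beta_k(x)-\min_x\beta_k(x)\le D$, where $D$ is a constant. Let $\mathrm{CP}_k(x,a)=\sum_y(\widehat P_k(y\mid x,a)-P(y\mid x,a))\beta_k(y)$. Then for every $\delta\ge\frac1{2T^2}$ the probability that $\mathcal E$ occurs and the bound $$\mathrm{Reg}_T\le\sum_{k=1}^m\sum_{t=t_k}^{t_{k+1}-1}\mathrm{CB}_k(x_t,\pi_k(x_t))+\sum_{k=1}^m\sum_{t=t_k}^{t_{k+1}-1}\mathrm{CP}_k(x_t,\pi_k(x_t))+Dm+D\sqrt{T\log T}$$ fails is at most $2\delta$. Moreover, for every $\delta\in(0,1)$ the same holds with $D\sqrt{T\log(1/\delta)}$ in place of $D\sqrt{T\log T}$. -/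

import Mathlib

open MeasureTheory

noncomputable section

namespace AvgReward

/-- `p x a y` is a transition function: `p x a` is a probability vector for every `x, a`. -/
def IsTransition {S A : Type*} [Fintype S] (p : S → A → S → ℝ) : Prop :=
  (∀ x a y, 0 ≤ p x a y) ∧ ∀ x a, ∑ y, p x a y = 1

/-- A finite Markov decision process with deterministic rewards. -/
structure MDP (S A : Type*) [Fintype S] where
  /-- `P x a y` is the probability of moving to `y` after playing `a` in `x`. -/
  P : S → A → S → ℝ
  r : S → A → ℝ
  isTransition : IsTransition P

section Gain

variable {S A : Type*} [Fintype S] [DecidableEq S]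

/-- Transition matrix of the Markov chain induced by a stationary policy. -/
def MDP.policyMatrix (M : MDP S A) (π : S → A) : Matrix S S ℝ :=
  Matrix.of fun x y => M.P x (π x) y

/-- Expected reward of `π` in round `t` (rounds counted from `0`) when started in `x`. -/
def MDP.expectedReward (M : MDP S A) (π : S → A) (t : ℕ) (x : S) : ℝ :=
  ((M.policyMatrix π ^ t).mulVec fun z => M.r z (π z)) x

/-- Long-run average reward of a stationary policy from the initial state `x`. -/
def MDP.gain (M : MDP S A) (π : S → A) (x : S) : ℝ :=
  Filter.limsup (fun n : ℕ => (∑ t ∈ Finset.range n, M.expectedReward π t x) / n) Filter.atTop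

/-- The optimal average reward: the maximum of the gain over stationary policies and initial
states. If the optimal gain does not depend on the initial state, it is that common value. -/
def MDP.optGain (M : MDP S A) : ℝ := ⨆ π : S → A, ⨆ x : S, M.gain π x

end Gain

/-- The data of an optimistic linear program: a reference transition function,
constraint-aggregation functions `w i` and confidence widths `b i`. -/
structure ConfModel (S A I : Type*) [Fintype S] where
  Phat : S → A → S → ℝ
  isTransition : IsTransition Phat
  w : I → S → ℝ
  b : I → S → A → ℝ
  b_nonneg : ∀ i x a, 0 ≤ b i x a

section Dual

variable {S A I : Type*} [Fintype S] [Fintype I]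

/-- The set of transition functions that satisfy the aggregated confidence constraints. -/
def ConfModel.confSet (C : ConfModel S A I) : Set (S → A → S → ℝ) :=
  {p | IsTransition p ∧ ∀ i x a, ∑ y, C.w i y * |p x a y - C.Phat x a y| ≤ C.b i x a}

/-- Objective values of the linear program that defines the bonus:
`∑ i, b i x a * μ i` over `c : ℝ`, `μ ≥ 0` with `∑ i, w i y * μ i ≥ |β y + c|` for all `y`. -/
def ConfModel.bonusValues (C : ConfModel S A I) (β : S → ℝ) (x : S) (a : A) : Set ℝ :=
  {v | ∃ (c : ℝ) (μ : I → ℝ), (∀ i, 0 ≤ μ i) ∧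
    (∀ y, |β y + c| ≤ ∑ i, C.w i y * μ i) ∧ v = ∑ i, C.b i x a * μ i}

/-- The bonus `CB(x, a)`: the optimal value of that program. It is the actual minimum
when the program is feasible; an infeasible program (value `+∞`) is excluded in `DualFeasible`. -/
def ConfModel.CB (C : ConfModel S A I) (β : S → ℝ) (x : S) (a : A) : ℝ :=
  sInf (C.bonusValues β x a)

/-- Feasibility for the dual program: minimize `ρ` subject to
`β x + ρ ≥ r x a + CB x a + ∑ y, Phat x a y * β y` for all `x, a`.
The bonus is the one induced by `β`, and it has to be finite. -/
def ConfModel.DualFeasible (C : ConfModel S A I) (r : S → A → ℝ) (β : S → ℝ) (ρ : ℝ) : Prop :=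
  ∀ x a, (C.bonusValues β x a).Nonempty ∧
    r x a + C.CB β x a + ∑ y, C.Phat x a y * β y ≤ β x + ρ

/-- `(β, ρ)` is an optimal solution of the dual program. -/
def ConfModel.DualOptimal (C : ConfModel S A I) (r : S → A → ℝ) (β : S → ℝ) (ρ : ℝ) : Prop :=
  C.DualFeasible r β ρ ∧ ∀ β' ρ', C.DualFeasible r β' ρ' → ρ ≤ ρ'

/-- The action `a` is optimal in `x` with respect to the dual solution `(β, ρ)`:
it attains equality in the dual constraint (the optimality equation). -/
def ConfModel.OptimalAction (C : ConfModel S A I) (r : S → A → ℝ) (β : S → ℝ) (ρ : ℝ)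
    (x : S) (a : A) : Prop :=
  β x + ρ = r x a + C.CB β x a + ∑ y, C.Phat x a y * β y

/-- `CP(x, a) = ∑ y, (Phat(y | x, a) - P(y | x, a)) β(y)`. -/
def ConfModel.CP (C : ConfModel S A I) (P : S → A → S → ℝ) (β : S → ℝ) (x : S) (a : A) : ℝ :=
  ∑ y, (C.Phat x a y - P x a y) * β y

end Dual

/-- The span `max β - min β`. -/
def span {S : Type*} (β : S → ℝ) : ℝ := (⨆ x, β x) - ⨅ x, β x

/-- A run of `T` rounds `t = 0, …, T - 1` in the MDP `M`, divided into the phases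
`k = 0, …, m - 1`: phase `k` consists of the rounds `τ k ≤ t < τ (k + 1)`, and the policy `π k` is
played in it. The phase boundaries and the number of phases may depend on the history, which
is recorded by the filtration `ℱ`; the function `β k` is computed from the history at the beginning
of phase `k`; and the next state is drawn from `P(· | x_t, a_t)` given the history. -/
structure IsPhasedRun {S A Ω : Type*} [Fintype S] {mΩ : MeasurableSpace Ω} (μ : Measure Ω)
    (ℱ : Filtration ℕ mΩ) (M : MDP S A) (T : ℕ) (X : ℕ → Ω → S) (act : ℕ → Ω → A)
    (τ : ℕ → Ω → ℕ) (m : Ω → ℕ) (π : ℕ → Ω → S → A) (β : ℕ → Ω → S → ℝ) : Prop where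
  state_adapted : ∀ t ≤ T, ∀ x, MeasurableSet[ℱ t] {ω | X t ω = x}
  act_adapted : ∀ t < T, ∀ a, MeasurableSet[ℱ t] {ω | act t ω = a}
  stopping : ∀ k, IsStoppingTime ℱ (fun ω => (τ k ω : WithTop ℕ))
  start : ∀ ω, τ 0 ω = 0
  mono : ∀ ω, Monotone fun k => τ k ω
  finish : ∀ ω, τ (m ω) ω = T
  dual_measurable : ∀ k, Measurable[(stopping k).measurableSpace] (β k)
  act_eq : ∀ ω, ∀ k < m ω, ∀ t ∈ Finset.Ico (τ k ω) (τ (k + 1) ω), act t ω = π k ω (X t ω)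
  transition : ∀ t < T, ∀ y,
    μ[{ω | X (t + 1) ω = y}.indicator (fun _ => (1 : ℝ)) | ℱ t]
      =ᵐ[μ] fun ω => M.P (X t ω) (act t ω) y

/-- The regret `∑_t (ρ* - r(x_t, a_t))`. -/
def regret {S A Ω : Type*} [Fintype S] [DecidableEq S] (M : MDP S A) (T : ℕ)
    (X : ℕ → Ω → S) (act : ℕ → Ω → A) (ω : Ω) : ℝ :=
  ∑ t ∈ Finset.range T, (M.optGain - M.r (X t ω) (act t ω))

/-- The event that the true transition function lies in the confidence sets of all phases. -/
def goodEvent {S A I Ω : Type*} [Fintype S] [Fintype I] (M : MDP S A)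
    (C : ℕ → Ω → ConfModel S A I) (m : Ω → ℕ) : Set Ω :=
  {ω | ∀ k < m ω, M.P ∈ (C k ω).confSet}

/-- `∑_k ∑_{t in phase k} f k (x_t) (π_k (x_t))`. -/
def phaseSum {S A Ω : Type*} (X : ℕ → Ω → S) (τ : ℕ → Ω → ℕ) (m : Ω → ℕ)
    (π : ℕ → Ω → S → A) (f : ℕ → Ω → S → A → ℝ) (ω : Ω) : ℝ :=
  ∑ k ∈ Finset.range (m ω), ∑ t ∈ Finset.Ico (τ k ω) (τ (k + 1) ω),
    f k ω (X t ω) (π k ω (X t ω))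

end AvgReward

end

/-! By weak linear programming duality, `CB` dominates the error `∑ y, (p x a y - Phat x a y) * β y`
of every `p` in the confidence set. So on the good event each pair (β_k, ρ_k) satisfies the Bellman
inequality of the true MDP, and iterating it gives ρ* ≤ ρ_k (`ConfModel.DualFeasible.optGain_le`).
With the optimality equation, a round of phase k then costs at most ρ_k - r = CB + CP + (Pβ_k -
β_k(x_{t+1})) + (β_k(x_{t+1}) - β_k(x_t)). The last bracket telescopes to at most D over a phase.
The other bracket is a martingale difference of conditional range D, and by Azuma–Hoeffding its sum
exceeds D√(TL) with probability at most exp(-2L) (`measure_noiseSum_gt_le`). The two claims are L =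
log T and L = log(1/δ). The span bound holds only on the good event, which need not be decided by
time t. The martingale is therefore built from `truncatedDual`, which is adapted, has span at most D
everywhere, and equals β_k on the good event. -/

namespace AvgReward

/-! ### Weak duality -/

section WeakDuality

variable {S A I : Type*} [Fintype S] [Fintype I]

/-- The rows of `p` and `Phat` have the same mass, so the shift `c` is free. The program's
constraint then bounds `|β y + c|`, and exchanging the sums leaves the confidence constraints
weighted by `μ`. -/
theorem ConfModel.sum_sub_mul_le_CB (C : ConfModel S A I) {p : S → A → S → ℝ}
    (hp : p ∈ C.confSet) {β : S → ℝ} {x : S} {a : A} (hne : (C.bonusValues β x a).Nonempty) :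
    ∑ y, (p x a y - C.Phat x a y) * β y ≤ C.CB β x a := by
  refine le_csInf hne ?_
  rintro v ⟨c, μ, hμ, hfeas, rfl⟩
  have hshift : ∑ y, (p x a y - C.Phat x a y) * β y
      = ∑ y, (p x a y - C.Phat x a y) * (β y + c) := by
    simp only [mul_add, Finset.sum_add_distrib, ← Finset.sum_mul, Finset.sum_sub_distrib,
      hp.1.2, C.isTransition.2]
    ring
  calc ∑ y, (p x a y - C.Phat x a y) * β y
      = ∑ y, (p x a y - C.Phat x a y) * (β y + c) := hshift
    _ ≤ ∑ y, |p x a y - C.Phat x a y| * ∑ i, C.w i y * μ i := by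
        refine Finset.sum_le_sum fun y _ => ?_
        refine (le_abs_self _).trans ?_
        rw [abs_mul]
        exact mul_le_mul_of_nonneg_left (hfeas y) (abs_nonneg _)
    _ = ∑ i, (∑ y, C.w i y * |p x a y - C.Phat x a y|) * μ i := by
        simp only [Finset.mul_sum, Finset.sum_mul]
        rw [Finset.sum_comm]
        refine Finset.sum_congr rfl fun i _ => Finset.sum_congr rfl fun y _ => ?_
        ring
    _ ≤ ∑ i, C.b i x a * μ i :=
        Finset.sum_le_sum fun i _ => mul_le_mul_of_nonneg_right (hp.2 i x a) (hμ i)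

/-- A dual feasible pair satisfies the Bellman inequality of every model in the confidence set. -/
theorem ConfModel.DualFeasible.bellman_le {C : ConfModel S A I} {r : S → A → ℝ} {β : S → ℝ}
    {ρ : ℝ} (h : C.DualFeasible r β ρ) {p : S → A → S → ℝ} (hp : p ∈ C.confSet) (x : S) (a : A) :
    r x a + ∑ y, p x a y * β y ≤ β x + ρ := by
  have h1 := C.sum_sub_mul_le_CB hp (h x a).1
  have h2 := (h x a).2
  simp only [sub_mul, Finset.sum_sub_distrib] at h1
  linarith

variable [DecidableEq S]

theorem MDP.policyMatrix_mem_rowStochastic (M : MDP S A) (π : S → A) :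
    M.policyMatrix π ∈ Matrix.rowStochastic ℝ S := by
  rw [Matrix.mem_rowStochastic_iff_sum]
  exact ⟨fun x y => M.isTransition.1 _ _ _, fun x => M.isTransition.2 _ _⟩

theorem rowStochastic_mulVec_mono {Q : Matrix S S ℝ} (hQ : Q ∈ Matrix.rowStochastic ℝ S)
    {f g : S → ℝ} (hfg : ∀ x, f x ≤ g x) (x : S) : Q.mulVec f x ≤ Q.mulVec g x :=
  Finset.sum_le_sum fun y _ => mul_le_mul_of_nonneg_left (hfg y) (hQ.1 x y)

theorem rowStochastic_mulVec_const {Q : Matrix S S ℝ} (hQ : Q ∈ Matrix.rowStochastic ℝ S)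
    (c : ℝ) (x : S) : Q.mulVec (fun _ => c) x = c := by
  simp only [Matrix.mulVec, dotProduct, ← Finset.sum_mul]
  rw [Matrix.sum_row_of_mem_rowStochastic hQ, one_mul]

/-- A solution of the Bellman inequality bounds the gain of every stationary policy. -/
theorem MDP.gain_le_of_bellman (M : MDP S A) {β : S → ℝ} {ρ : ℝ}
    (h : ∀ x a, M.r x a + ∑ y, M.P x a y * β y ≤ β x + ρ) (π : S → A) (x : S) :
    M.gain π x ≤ ρ := by
  set Q := M.policyMatrix π with hQdef
  have hQ : ∀ t : ℕ, Q ^ t ∈ Matrix.rowStochastic ℝ S := fun t =>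
    pow_mem (M.policyMatrix_mem_rowStochastic π) t
  obtain ⟨B, hB⟩ : ∃ B, ∀ z, |β z| ≤ B :=
    ⟨∑ z, |β z|, fun z => Finset.single_le_sum (f := fun z => |β z|)
      (fun _ _ => abs_nonneg _) (Finset.mem_univ z)⟩
  obtain ⟨R, hR⟩ : ∃ R, ∀ z, |M.r z (π z)| ≤ R :=
    ⟨∑ z, |M.r z (π z)|, fun z => Finset.single_le_sum (f := fun z => |M.r z (π z)|)
      (fun _ _ => abs_nonneg _) (Finset.mem_univ z)⟩
  have hlower : ∀ t, -R ≤ M.expectedReward π t x := fun t => by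
    have := rowStochastic_mulVec_mono (hQ t) (f := fun _ => -R) (g := fun z => M.r z (π z))
      (fun z => (abs_le.1 (hR z)).1) x
    rwa [rowStochastic_mulVec_const (hQ t)] at this
  have hstep : ∀ t, M.expectedReward π t x
      ≤ (Q ^ t).mulVec β x - (Q ^ (t + 1)).mulVec β x + ρ := fun t => by
    -- The Bellman inequality along `π` reads r ≤ β - Qβ + ρ pointwise, and the nonnegative matrix
    -- `Q ^ t` preserves it.
    have hle := rowStochastic_mulVec_mono (hQ t) (f := fun z => M.r z (π z))
      (g := β - Q.mulVec β + fun _ => ρ) (fun z => by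
        have := h z (π z)
        change _ ≤ β z - (∑ y, M.P z (π z) y * β y) + ρ
        linarith) x
    rw [Matrix.mulVec_add, Matrix.mulVec_sub, Matrix.mulVec_mulVec, ← pow_succ] at hle
    simp only [Pi.add_apply, Pi.sub_apply, rowStochastic_mulVec_const (hQ t)] at hle
    exact hle
  -- The differences telescope; only the two boundary terms, each at most `B` in absolute value,
  -- remain.
  have hsum : ∀ n : ℕ, ∑ t ∈ Finset.range n, M.expectedReward π t x ≤ 2 * B + n * ρ := fun n => by
    have hn : ∑ t ∈ Finset.range n, M.expectedReward π t x
        ≤ (Q ^ 0).mulVec β x - (Q ^ n).mulVec β x + n * ρ := by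
      induction n with
      | zero => simp
      | succ n ih =>
        rw [Finset.sum_range_succ]
        have := hstep n
        push_cast
        linarith
    have h0 : (Q ^ 0).mulVec β x ≤ B := by
      simpa using (abs_le.1 (hB x)).2
    have h1 := rowStochastic_mulVec_mono (hQ n) (f := fun _ => -B) (g := β)
      (fun z => (abs_le.1 (hB z)).1) x
    rw [rowStochastic_mulVec_const (hQ n)] at h1
    linarith
  -- A real `limsup` is monotone only under boundedness conditions; the lower bound `-R` on the
  -- averages supplies this one.
  have hco : Filter.IsCoboundedUnder (· ≤ ·) Filter.atTop
      (fun n : ℕ => (∑ t ∈ Finset.range n, M.expectedReward π t x) / n) := by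
    refine Filter.IsBoundedUnder.isCoboundedUnder_le ⟨-R, ?_⟩
    rw [Filter.eventually_map]
    filter_upwards [Filter.eventually_gt_atTop 0] with n hn
    have hn' : (0 : ℝ) < n := by exact_mod_cast hn
    have := Finset.card_nsmul_le_sum (Finset.range n) (fun t => M.expectedReward π t x) (-R)
      (fun t _ => hlower t)
    rw [Finset.card_range, nsmul_eq_mul] at this
    change -R ≤ _
    rw [le_div_iff₀ hn']
    linarith
  have hlim : Filter.Tendsto (fun n : ℕ => 2 * B / (n : ℝ) + ρ) Filter.atTop (nhds ρ) := by
    simpa using (tendsto_const_div_atTop_nhds_zero_nat (2 * B)).add_const ρ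
  rw [MDP.gain, ← hlim.limsup_eq]
  refine Filter.limsup_le_limsup ?_ hco hlim.isBoundedUnder_le
  filter_upwards [Filter.eventually_gt_atTop 0] with n hn
  have hn' : (0 : ℝ) < n := by exact_mod_cast hn
  rw [div_le_iff₀ hn', add_mul, div_mul_cancel₀ _ hn'.ne']
  linarith [hsum n]

theorem ConfModel.DualFeasible.optGain_le [Nonempty S] [Nonempty A] {M : MDP S A}
    {C : ConfModel S A I} {β : S → ℝ} {ρ : ℝ} (h : C.DualFeasible M.r β ρ)
    (hP : M.P ∈ C.confSet) : M.optGain ≤ ρ :=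
  ciSup_le fun π => ciSup_le fun x => M.gain_le_of_bellman (h.bellman_le hP) π x

end WeakDuality

/-! ### Span and phases -/

theorem sub_le_span {S : Type*} [Finite S] (β : S → ℝ) (y z : S) : β y - β z ≤ span β :=
  sub_le_sub (le_ciSup (Set.finite_range β).bddAbove y) (ciInf_le (Set.finite_range β).bddBelow z)

theorem span_nonneg {S : Type*} [Finite S] [Nonempty S] (β : S → ℝ) : 0 ≤ span β := by
  have y := Classical.arbitrary S
  simpa using sub_le_span β y y

theorem sum_phases_eq_sum_range {τ : ℕ → ℕ} (h0 : τ 0 = 0) (hτ : Monotone τ) (f : ℕ → ℝ) (n : ℕ) :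
    ∑ k ∈ Finset.range n, ∑ t ∈ Finset.Ico (τ k) (τ (k + 1)), f t
      = ∑ t ∈ Finset.range (τ n), f t := by
  induction n with
  | zero => simp [h0]
  | succ n ih =>
    rw [Finset.sum_range_succ, ih, Finset.range_eq_Ico, Finset.range_eq_Ico,
      Finset.sum_Ico_consecutive _ (Nat.zero_le _) (hτ n.le_succ)]

/-! ### Hoeffding's lemma for a probability vector -/

theorem sum_exp_le_of_sub_le {S : Type*} [Fintype S] {p f : S → ℝ} {D : ℝ}
    (hp : ∀ y, 0 ≤ p y) (hp1 : ∑ y, p y = 1) (hf : ∀ y z, f y - f z ≤ D) (l : ℝ) :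
    ∑ y, p y * Real.exp (l * (∑ z, p z * f z - f y)) ≤ Real.exp (l ^ 2 * D ^ 2 / 8) := by
  classical
  let _ : MeasurableSpace S := ⊤
  have hne : Nonempty S := by
    by_contra hS
    rw [not_nonempty_iff] at hS
    simp at hp1
  obtain ⟨z₀, hz₀⟩ := Finite.exists_min f
  let q : PMF S := PMF.ofFintype (fun y => ENNReal.ofReal (p y)) (by
    rw [← ENNReal.ofReal_sum_of_nonneg fun y _ => hp y, hp1, ENNReal.ofReal_one])
  have hq : ∀ y, (q y).toReal = p y := fun y => by
    simp [q, ENNReal.toReal_ofReal (hp y)]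
  have hsub := ProbabilityTheory.hasSubgaussianMGF_of_mem_Icc (μ := q.toMeasure) (X := f)
    (a := f z₀) (b := f z₀ + D) (measurable_from_top).aemeasurable
    (Filter.Eventually.of_forall fun y => ⟨hz₀ y, by linarith [hf y z₀]⟩)
  -- The sign is reversed because the deviation here is mean minus value.
  have hm := hsub.mgf_le (-l)
  rw [ProbabilityTheory.mgf, PMF.integral_eq_sum, PMF.integral_eq_sum] at hm
  simp only [hq, smul_eq_mul] at hm
  refine (le_of_eq (Finset.sum_congr rfl fun y _ => ?_)).trans (hm.trans_eq (congrArg _ ?_))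
  · congr 2
    ring
  · simp only [NNReal.coe_pow, NNReal.coe_div, coe_nnnorm, NNReal.coe_ofNat, add_sub_cancel_left,
      div_pow, Real.norm_eq_abs, sq_abs]
    ring

/-! ### An Azuma–Hoeffding inequality for the one-step noise -/

section Noise

variable {S Ω : Type*} [Fintype S]

/-- The accumulated differences between the predicted value `∑ y, p s y * b s y` and the value
`b s (X (s + 1))` that is realized one step later. -/
noncomputable def noiseSum (p b : ℕ → Ω → S → ℝ) (X : ℕ → Ω → S) (t : ℕ) (ω : Ω) : ℝ :=
  ∑ s ∈ Finset.range t, (∑ y, p s ω y * b s ω y - b s ω (X (s + 1) ω))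

theorem abs_sum_mul_sub_le {p f : S → ℝ} {D : ℝ} (hp : ∀ y, 0 ≤ p y) (hp1 : ∑ y, p y = 1)
    (hf : ∀ y z, f y - f z ≤ D) (x : S) : |∑ y, p y * f y - f x| ≤ D := by
  have h : ∑ y, p y * f y - f x = ∑ y, p y * (f y - f x) := by
    simp only [mul_sub, Finset.sum_sub_distrib, ← Finset.sum_mul, hp1, one_mul]
  rw [h]
  calc |∑ y, p y * (f y - f x)| ≤ ∑ y, |p y * (f y - f x)| := Finset.abs_sum_le_sum_abs _ _
    _ ≤ ∑ y, p y * D := Finset.sum_le_sum fun y _ => by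
        rw [abs_mul, abs_of_nonneg (hp y)]
        exact mul_le_mul_of_nonneg_left
          (abs_le.2 ⟨by linarith [hf x y], hf y x⟩) (hp y)
    _ = D := by rw [← Finset.sum_mul, hp1, one_mul]

theorem abs_noiseSum_le {p b : ℕ → Ω → S → ℝ} {D : ℝ} (X : ℕ → Ω → S)
    (hp : ∀ t ω y, 0 ≤ p t ω y) (hp1 : ∀ t ω, ∑ y, p t ω y = 1)
    (hb : ∀ t ω y z, b t ω y - b t ω z ≤ D) (t : ℕ) (ω : Ω) :
    |noiseSum p b X t ω| ≤ t * D := by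
  refine (Finset.abs_sum_le_sum_abs _ _).trans ?_
  refine (Finset.sum_le_sum fun s _ =>
    abs_sum_mul_sub_le (hp s ω) (hp1 s ω) (hb s ω) (X (s + 1) ω)).trans ?_
  simp

/-- `S` carries no σ-algebra, so the composition is written as a finite sum over the level sets of
`X`. -/
theorem measurable_eval_of_measurableSet {m : MeasurableSpace Ω} {X : Ω → S} {f : S → Ω → ℝ}
    (hX : ∀ x, MeasurableSet {ω | X ω = x}) (hf : ∀ x, Measurable (f x)) :
    Measurable fun ω => f (X ω) ω := by
  have h : (fun ω => f (X ω) ω) = fun ω => ∑ x, {ω | X ω = x}.indicator (f x) ω := by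
    classical
    funext ω
    simp [Set.indicator_apply]
  rw [h]
  exact Finset.measurable_fun_sum _ fun x _ => (hf x).indicator (hX x)

variable {mΩ : MeasurableSpace Ω} {μ : Measure Ω} {ℱ : Filtration ℕ mΩ} {T : ℕ}
  {p b : ℕ → Ω → S → ℝ} {X : ℕ → Ω → S} {D : ℝ}

theorem measurable_noiseSum (hX : ∀ t ≤ T, ∀ x, MeasurableSet[ℱ t] {ω | X t ω = x})
    (hpm : ∀ t < T, ∀ y, Measurable[ℱ t] fun ω => p t ω y)
    (hbm : ∀ t < T, ∀ y, Measurable[ℱ t] fun ω => b t ω y) {t : ℕ} (ht : t ≤ T) :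
    Measurable[ℱ t] (noiseSum p b X t) := by
  refine Finset.measurable_fun_sum _ fun s hs => ?_
  have hst : s < t := Finset.mem_range.1 hs
  have hb' : ∀ y, Measurable[ℱ t] fun ω => b s ω y := fun y =>
    (hbm s (hst.trans_le ht) y).mono (ℱ.mono hst.le) le_rfl
  have hp' : ∀ y, Measurable[ℱ t] fun ω => p s ω y := fun y =>
    (hpm s (hst.trans_le ht) y).mono (ℱ.mono hst.le) le_rfl
  refine Measurable.sub (Finset.measurable_fun_sum _ fun y _ => (hp' y).mul (hb' y)) ?_
  exact measurable_eval_of_measurableSet (m := ℱ t) (f := fun y ω => b s ω y)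
    (fun x => ℱ.mono hst _ (hX (s + 1) (hst.trans_le ht) x)) hb'

theorem integral_mul_indicator_eq [IsProbabilityMeasure μ] {m : MeasurableSpace Ω} (hm : m ≤ mΩ)
    {s : Set Ω} (hs : MeasurableSet[mΩ] s) {f q : Ω → ℝ} (hf : Measurable[m] f) {B : ℝ}
    (hB : ∀ ω, |f ω| ≤ B) (hq : μ[s.indicator (fun _ => (1 : ℝ)) | m] =ᵐ[μ] q) :
    ∫ ω, f ω * s.indicator (fun _ => (1 : ℝ)) ω ∂μ = ∫ ω, f ω * q ω ∂μ := by
  have hi : Integrable (s.indicator fun _ => (1 : ℝ)) μ := (integrable_const 1).indicator hs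
  have hfi : Integrable (f * s.indicator fun _ => (1 : ℝ)) μ :=
    hi.bdd_mul (hf.mono hm le_rfl).aestronglyMeasurable (Filter.Eventually.of_forall hB)
  have h1 := condExp_mul_of_stronglyMeasurable_left hf.stronglyMeasurable hfi hi
  calc ∫ ω, f ω * s.indicator (fun _ => (1 : ℝ)) ω ∂μ
      = ∫ ω, (μ[f * s.indicator fun _ => (1 : ℝ) | m]) ω ∂μ := (integral_condExp hm).symm
    _ = ∫ ω, f ω * q ω ∂μ := integral_congr_ae <| by
        filter_upwards [h1, hq] with ω h1 h2
        rw [h1, Pi.mul_apply, h2]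

theorem integrable_of_measurable_of_abs_le [IsProbabilityMeasure μ] {f : Ω → ℝ} {B : ℝ}
    (hf : Measurable f) (hB : ∀ ω, |f ω| ≤ B) : Integrable f μ :=
  Integrable.of_bound hf.aestronglyMeasurable B (Filter.Eventually.of_forall hB)

/-- Splitting over the finitely many values `y` of the next state leaves `ℱ t`-measurable weights
times indicators. Conditioning replaces each indicator by its transition probability, and
Hoeffding's lemma gives one more factor. -/
theorem integral_exp_noiseSum_le [IsProbabilityMeasure μ]
    (hX : ∀ t ≤ T, ∀ x, MeasurableSet[ℱ t] {ω | X t ω = x})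
    (hpm : ∀ t < T, ∀ y, Measurable[ℱ t] fun ω => p t ω y)
    (hbm : ∀ t < T, ∀ y, Measurable[ℱ t] fun ω => b t ω y)
    (hp : ∀ t ω y, 0 ≤ p t ω y) (hp1 : ∀ t ω, ∑ y, p t ω y = 1)
    (hb : ∀ t ω y z, b t ω y - b t ω z ≤ D)
    (htrans : ∀ t < T, ∀ y, μ[{ω | X (t + 1) ω = y}.indicator (fun _ => (1 : ℝ)) | ℱ t]
      =ᵐ[μ] fun ω => p t ω y) (l : ℝ) {t : ℕ} (ht : t ≤ T) :
    ∫ ω, Real.exp (l * noiseSum p b X t ω) ∂μ ≤ Real.exp (t * (l ^ 2 * D ^ 2 / 8)) := by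
  classical
  induction t with
  | zero => simp [noiseSum]
  | succ t ih =>
    have htT : t < T := ht
    -- the exponential weight when the next state is `y`
    let G : S → Ω → ℝ := fun y ω =>
      Real.exp (l * noiseSum p b X t ω) * Real.exp (l * (∑ z, p t ω z * b t ω z - b t ω y))
    have hNm := measurable_noiseSum hX hpm hbm htT.le
    have hGm : ∀ y, Measurable[ℱ t] (G y) := fun y => by
      refine Measurable.mul (hNm.const_mul l).exp (Measurable.exp (Measurable.const_mul ?_ l))
      exact (Finset.measurable_fun_sum _ fun z _ => (hpm t htT z).mul (hbm t htT z)).sub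
        (hbm t htT y)
    have habs : ∀ {u c : ℝ}, |u| ≤ c → Real.exp (l * u) ≤ Real.exp (|l| * c) := fun hu =>
      Real.exp_le_exp.2 ((le_abs_self _).trans (by
        rw [abs_mul]; exact mul_le_mul_of_nonneg_left hu (abs_nonneg l)))
    have hGB : ∀ y ω, |G y ω| ≤ Real.exp (|l| * (t * D)) * Real.exp (|l| * D) := fun y ω => by
      rw [abs_of_pos (by positivity)]
      exact mul_le_mul (habs (abs_noiseSum_le X hp hp1 hb t ω))
        (habs (abs_sum_mul_sub_le (hp t ω) (hp1 t ω) (hb t ω) y)) (by positivity) (by positivity)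
    have hs : ∀ y, MeasurableSet {ω | X (t + 1) ω = y} := fun y =>
      ℱ.le (t + 1) _ (hX (t + 1) ht y)
    have hGi : ∀ y, Integrable (G y) μ := fun y =>
      integrable_of_measurable_of_abs_le ((hGm y).mono (ℱ.le t) le_rfl) (hGB y)
    have hp_le : ∀ ω y, p t ω y ≤ 1 := fun ω y =>
      (Finset.single_le_sum (fun z _ => hp t ω z) (Finset.mem_univ y)).trans (hp1 t ω).le
    have hGpi : ∀ y, Integrable (fun ω => G y ω * p t ω y) μ := fun y =>
      (hGi y).mul_bdd (c := 1) ((hpm t htT y).mono (ℱ.le t) le_rfl).aestronglyMeasurable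
        (Filter.Eventually.of_forall fun ω => by
          rw [Real.norm_of_nonneg (hp t ω y)]; exact hp_le ω y)
    have hsplit : ∀ ω, Real.exp (l * noiseSum p b X (t + 1) ω)
        = ∑ y, G y ω * {ω | X (t + 1) ω = y}.indicator (fun _ => (1 : ℝ)) ω := fun ω => by
      simp only [Set.indicator_apply, Set.mem_ofPred_eq, mul_ite, mul_one, mul_zero,
        Finset.sum_ite_eq, Finset.mem_univ, if_true, G]
      rw [← Real.exp_add, ← mul_add, noiseSum, noiseSum, Finset.sum_range_succ]
    calc ∫ ω, Real.exp (l * noiseSum p b X (t + 1) ω) ∂μ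
        = ∑ y, ∫ ω, G y ω * {ω | X (t + 1) ω = y}.indicator (fun _ => (1 : ℝ)) ω ∂μ := by
          simp only [hsplit]
          refine integral_finsetSum _ fun y _ => ?_
          exact ((integrable_const (1 : ℝ)).indicator (hs y)).bdd_mul (c := _)
            (hGi y).aestronglyMeasurable (Filter.Eventually.of_forall (hGB y))
      _ = ∑ y, ∫ ω, G y ω * p t ω y ∂μ := Finset.sum_congr rfl fun y _ =>
          integral_mul_indicator_eq (ℱ.le t) (hs y) (hGm y) (hGB y) (htrans t htT y)
      _ = ∫ ω, ∑ y, G y ω * p t ω y ∂μ := (integral_finsetSum _ fun y _ => hGpi y).symm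
      _ ≤ ∫ ω, Real.exp (l * noiseSum p b X t ω) * Real.exp (l ^ 2 * D ^ 2 / 8) ∂μ := by
          refine integral_mono (integrable_finsetSum _ fun y _ => hGpi y) ?_ fun ω => ?_
          · refine Integrable.mul_const ?_ _
            refine integrable_of_measurable_of_abs_le (B := Real.exp (|l| * (t * D)))
              ((hNm.mono (ℱ.le t) le_rfl).const_mul l).exp fun ω => ?_
            rw [Real.abs_exp]
            exact habs (abs_noiseSum_le X hp hp1 hb t ω)
          · have h := sum_exp_le_of_sub_le (hp t ω) (hp1 t ω) (hb t ω) l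
            refine le_trans (le_of_eq ?_) (mul_le_mul_of_nonneg_left h (Real.exp_pos _).le)
            rw [Finset.mul_sum]
            exact Finset.sum_congr rfl fun y _ => by simp only [G]; ring
      _ ≤ Real.exp (t * (l ^ 2 * D ^ 2 / 8)) * Real.exp (l ^ 2 * D ^ 2 / 8) := by
          rw [integral_mul_const]
          exact mul_le_mul_of_nonneg_right (ih htT.le) (Real.exp_pos _).le
      _ = Real.exp ((t + 1 : ℕ) * (l ^ 2 * D ^ 2 / 8)) := by
          rw [← Real.exp_add]
          push_cast
          ring_nf

/-- The sub-Gaussian tail of the accumulated noise. -/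
theorem measure_noiseSum_gt_le [IsProbabilityMeasure μ]
    (hX : ∀ t ≤ T, ∀ x, MeasurableSet[ℱ t] {ω | X t ω = x})
    (hpm : ∀ t < T, ∀ y, Measurable[ℱ t] fun ω => p t ω y)
    (hbm : ∀ t < T, ∀ y, Measurable[ℱ t] fun ω => b t ω y)
    (hp : ∀ t ω y, 0 ≤ p t ω y) (hp1 : ∀ t ω, ∑ y, p t ω y = 1)
    (hb : ∀ t ω y z, b t ω y - b t ω z ≤ D)
    (htrans : ∀ t < T, ∀ y, μ[{ω | X (t + 1) ω = y}.indicator (fun _ => (1 : ℝ)) | ℱ t]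
      =ᵐ[μ] fun ω => p t ω y) (hD : 0 ≤ D) {L : ℝ} (hL : 0 ≤ L) :
    μ {ω | D * √(T * L) < noiseSum p b X T ω} ≤ ENNReal.ofReal (Real.exp (-(2 * L))) := by
  have hbound := abs_noiseSum_le X hp hp1 hb T
  -- If `T * D = 0` the noise vanishes and the strict event is empty; otherwise the division in `l`
  -- below is legitimate.
  rcases (mul_nonneg (Nat.cast_nonneg T) hD : (0 : ℝ) ≤ T * D).eq_or_lt with h0 | hpos
  · have hempty : {ω | D * √(T * L) < noiseSum p b X T ω} = ∅ := by
      refine Set.eq_empty_of_forall_notMem fun ω hω => ?_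
      have h1 : D * √(T * L) < noiseSum p b X T ω := hω
      have h2 := (le_abs_self _).trans (hbound ω)
      have h3 : 0 ≤ D * √(T * L) := by positivity
      linarith
    rw [hempty, measure_empty]
    exact zero_le
  have hDpos : 0 < D := pos_of_mul_pos_right hpos (Nat.cast_nonneg T)
  have hTpos : (0 : ℝ) < T := pos_of_mul_pos_left hpos hD
  set e := D * √(T * L) with he
  have hesq : e ^ 2 = D ^ 2 * (T * L) := by
    rw [he, mul_pow, Real.sq_sqrt (by positivity)]
  -- This minimizes the Chernoff exponent -l e + T l² D² / 8, with minimum -2e²/(T D²) = -2L.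
  set l := 4 * e / (T * D ^ 2) with hl
  have hl0 : 0 ≤ l := by positivity
  have hNm := (measurable_noiseSum hX hpm hbm le_rfl).mono (ℱ.le T) le_rfl
  have hint : Integrable (fun ω => Real.exp (l * noiseSum p b X T ω)) μ := by
    refine integrable_of_measurable_of_abs_le (B := Real.exp (l * (T * D)))
      (hNm.const_mul l).exp fun ω => ?_
    rw [Real.abs_exp]
    exact Real.exp_le_exp.2 (mul_le_mul_of_nonneg_left ((le_abs_self _).trans (hbound ω)) hl0)
  have hch := ProbabilityTheory.measure_ge_le_exp_mul_mgf (μ := μ) (X := noiseSum p b X T)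
    e hl0 hint
  have hmgf : ProbabilityTheory.mgf (noiseSum p b X T) μ l ≤ Real.exp (T * (l ^ 2 * D ^ 2 / 8)) :=
    integral_exp_noiseSum_le hX hpm hbm hp hp1 hb htrans l le_rfl
  have hfin : μ.real {ω | e ≤ noiseSum p b X T ω} ≤ Real.exp (-(2 * L)) := by
    refine hch.trans ((mul_le_mul_of_nonneg_left hmgf (Real.exp_pos _).le).trans (le_of_eq ?_))
    rw [← Real.exp_add]
    congr 1
    have h1 : l * e = 4 * L := by
      rw [hl, div_mul_eq_mul_div, mul_assoc, ← sq, hesq]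
      field_simp
    have h2 : T * (l ^ 2 * D ^ 2 / 8) = l * e / 2 := by
      rw [hl]
      field_simp
      ring
    rw [h2, neg_mul, h1]
    ring
  calc μ {ω | e < noiseSum p b X T ω} ≤ μ {ω | e ≤ noiseSum p b X T ω} :=
        measure_mono fun ω (hω : e < _) => hω.le
    _ = ENNReal.ofReal (μ.real {ω | e ≤ noiseSum p b X T ω}) := by
        rw [ofReal_measureReal]
    _ ≤ ENNReal.ofReal (Real.exp (-(2 * L))) := ENNReal.ofReal_le_ofReal hfin

end Noise

/-! ### The phase of a round -/

section Phases

variable {S A I Ω : Type*}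

/-- The phase that contains the round `t`. -/
noncomputable def phaseIndex (τ : ℕ → Ω → ℕ) (t : ℕ) (ω : Ω) : ℕ := sInf {k | t < τ (k + 1) ω}

theorem phaseIndex_eq {τ : ℕ → Ω → ℕ} {t k : ℕ} {ω : Ω} (hτ : Monotone fun k => τ k ω)
    (h1 : τ k ω ≤ t) (h2 : t < τ (k + 1) ω) : phaseIndex τ t ω = k := by
  refine le_antisymm (Nat.sInf_le h2) (le_csInf ⟨k, h2⟩ fun j hj => ?_)
  by_contra! hjk
  have hj' : t < τ (j + 1) ω := hj
  exact absurd (hj'.trans_le (hτ hjk)) (not_lt.2 h1)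

/-- The predecessor of the least index fails the defining inequality, which is the lower bound;
index `0` is covered by the start at round `0`. -/
theorem phaseIndex_spec {τ : ℕ → Ω → ℕ} {t n : ℕ} {ω : Ω} (h0 : τ 0 ω = 0) (hn : t < τ n ω) :
    τ (phaseIndex τ t ω) ω ≤ t ∧ t < τ (phaseIndex τ t ω + 1) ω := by
  have hne : {k | t < τ (k + 1) ω}.Nonempty := by
    cases n with
    | zero => omega
    | succ n => exact ⟨n, hn⟩
  refine ⟨?_, Nat.sInf_mem hne⟩
  cases hk : phaseIndex τ t ω with
  | zero => omega
  | succ k =>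
    have := Nat.notMem_of_lt_sInf (show k < sInf {k | t < τ (k + 1) ω} by
      change k < phaseIndex τ t ω
      omega)
    exact not_lt.1 this

/-- The dual function in force in round `t`, replaced by `0` where its span exceeds `D`. -/
noncomputable def truncatedDual (τ : ℕ → Ω → ℕ) (β : ℕ → Ω → S → ℝ) (D : ℝ) (t : ℕ) (ω : Ω)
    (x : S) : ℝ :=
  {ω | ∀ y z, β (phaseIndex τ t ω) ω y - β (phaseIndex τ t ω) ω z ≤ D}.indicator
    (fun ω => β (phaseIndex τ t ω) ω x) ω

theorem truncatedDual_sub_le (τ : ℕ → Ω → ℕ) (β : ℕ → Ω → S → ℝ) {D : ℝ} (hD : 0 ≤ D) (t : ℕ)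
    (ω : Ω) (y z : S) : truncatedDual τ β D t ω y - truncatedDual τ β D t ω z ≤ D := by
  by_cases h : ω ∈ {ω | ∀ y z, β (phaseIndex τ t ω) ω y - β (phaseIndex τ t ω) ω z ≤ D}
  · simp only [truncatedDual, Set.indicator_of_mem h]
    exact h y z
  · simpa only [truncatedDual, Set.indicator_of_notMem h, sub_self] using hD

theorem truncatedDual_eq [Finite S] {τ : ℕ → Ω → ℕ} {β : ℕ → Ω → S → ℝ} {D : ℝ} {t k : ℕ} {ω : Ω}
    (hτ : Monotone fun k => τ k ω) (h1 : τ k ω ≤ t) (h2 : t < τ (k + 1) ω)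
    (hspan : span (β k ω) ≤ D) (x : S) : truncatedDual τ β D t ω x = β k ω x := by
  have hk := phaseIndex_eq hτ h1 h2
  have h : ω ∈ {ω | ∀ y z, β (phaseIndex τ t ω) ω y - β (phaseIndex τ t ω) ω z ≤ D} := by
    intro y z
    rw [hk]
    exact (sub_le_span _ y z).trans hspan
  rw [truncatedDual, Set.indicator_of_mem h, hk]

variable [Fintype S] {mΩ : MeasurableSpace Ω} {μ : Measure Ω}
  {ℱ : Filtration ℕ mΩ} {M : MDP S A} {T : ℕ} {X : ℕ → Ω → S} {act : ℕ → Ω → A} {τ : ℕ → Ω → ℕ}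
  {m : Ω → ℕ} {π : ℕ → Ω → S → A} {β : ℕ → Ω → S → ℝ}

theorem IsPhasedRun.measurable_transition [Fintype A] (h : IsPhasedRun μ ℱ M T X act τ m π β)
    {t : ℕ} (ht : t < T) (y : S) : Measurable[ℱ t] fun ω => M.P (X t ω) (act t ω) y := by
  refine measurable_eval_of_measurableSet (m := ℱ t) (f := fun x ω => M.P x (act t ω) y)
    (h.state_adapted t ht.le) fun x => ?_
  exact measurable_eval_of_measurableSet (m := ℱ t) (f := fun a _ => M.P x a y)
    (h.act_adapted t ht) fun a => measurable_const

theorem IsPhasedRun.measurableSet_phase_start_le (h : IsPhasedRun μ ℱ M T X act τ m π β) (k t : ℕ) :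
    MeasurableSet[ℱ t] {ω | τ k ω ≤ t} := by
  have := h.stopping k t
  simpa only [ENat.some_eq_natCast, Nat.cast_le] using this

/-- Which phase is current is known at time t, as the boundaries are stopping times. An event of the
σ-algebra at `τ k`, intersected with `{τ k ≤ t}`, lies in `ℱ t`. -/
theorem IsPhasedRun.measurable_dual (h : IsPhasedRun μ ℱ M T X act τ m π β)
    {t : ℕ} (ht : t < T) (x : S) : Measurable[ℱ t] fun ω => β (phaseIndex τ t ω) ω x := by
  intro B hB
  have hset : (fun ω => β (phaseIndex τ t ω) ω x) ⁻¹' B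
      = ⋃ k, ((fun ω => β k ω x) ⁻¹' B ∩ {ω | τ k ω ≤ t}) ∩ {ω | τ (k + 1) ω ≤ t}ᶜ := by
    ext ω
    simp only [Set.mem_preimage, Set.mem_iUnion, Set.mem_inter_iff, Set.mem_compl_iff,
      Set.mem_ofPred_eq, not_le]
    constructor
    · intro hω
      obtain ⟨h1, h2⟩ := phaseIndex_spec (h.start ω) (ht.trans_eq (h.finish ω).symm)
      exact ⟨_, ⟨hω, h1⟩, h2⟩
    · rintro ⟨k, ⟨hω, h1⟩, h2⟩
      rwa [phaseIndex_eq (h.mono ω) h1 h2]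
  rw [hset]
  refine MeasurableSet.iUnion fun k => MeasurableSet.inter ?_ (h.measurableSet_phase_start_le (k + 1) t).compl
  have hk : Measurable[(h.stopping k).measurableSpace] fun ω => β k ω x :=
    (measurable_pi_apply x).comp (h.dual_measurable k)
  have := ((h.stopping k).measurableSet _).1 (hk hB)
  simpa only [ENat.some_eq_natCast, Nat.cast_le] using this.2 t

theorem IsPhasedRun.measurable_truncatedDual (h : IsPhasedRun μ ℱ M T X act τ m π β) (D : ℝ)
    {t : ℕ} (ht : t < T) (x : S) : Measurable[ℱ t] fun ω => truncatedDual τ β D t ω x := by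
  refine (h.measurable_dual ht x).indicator ?_
  simp only [Set.ofPred_forall]
  exact MeasurableSet.iInter fun y => MeasurableSet.iInter fun z =>
    ((h.measurable_dual ht y).sub (h.measurable_dual ht z)) measurableSet_Iic

/-! ### The regret decomposition -/

variable [DecidableEq S] [Nonempty S] [Nonempty A] [Fintype I]

/-- On the good event the regret is at most the sum of the bonuses, the prediction errors, the
telescoping terms of the phases and the accumulated noise. -/
theorem IsPhasedRun.regret_le (h : IsPhasedRun μ ℱ M T X act τ m π β)
    {C : ℕ → Ω → ConfModel S A I} {ρ : ℕ → Ω → ℝ} {D : ℝ} {ω : Ω} (hω : ω ∈ goodEvent M C m)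
    (hdual : ∀ k < m ω, (C k ω).DualFeasible M.r (β k ω) (ρ k ω))
    (hpolicy : ∀ k < m ω, ∀ t ∈ Finset.Ico (τ k ω) (τ (k + 1) ω),
      (C k ω).OptimalAction M.r (β k ω) (ρ k ω) (X t ω) (π k ω (X t ω)))
    (hspan : ∀ k < m ω, span (β k ω) ≤ D) :
    regret M T X act ω ≤ phaseSum X τ m π (fun k ω => (C k ω).CB (β k ω)) ω
      + phaseSum X τ m π (fun k ω => (C k ω).CP M.P (β k ω)) ω + D * m ω
      + noiseSum (fun t ω => M.P (X t ω) (act t ω)) (truncatedDual τ β D) X T ω := by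
  have hsplit : ∀ f : ℕ → ℝ, ∑ t ∈ Finset.range T, f t
      = ∑ k ∈ Finset.range (m ω), ∑ t ∈ Finset.Ico (τ k ω) (τ (k + 1) ω), f t := fun f => by
    rw [sum_phases_eq_sum_range (h.start ω) (h.mono ω), h.finish ω]
  have hDm : D * m ω = ∑ k ∈ Finset.range (m ω), D := by
    rw [Finset.sum_const, Finset.card_range, nsmul_eq_mul, mul_comm]
  rw [regret, noiseSum, hsplit, hsplit, phaseSum, phaseSum, hDm, ← Finset.sum_add_distrib,
    ← Finset.sum_add_distrib, ← Finset.sum_add_distrib]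
  refine Finset.sum_le_sum fun k hk => ?_
  have hk : k < m ω := Finset.mem_range.1 hk
  have hτk : τ k ω ≤ τ (k + 1) ω := h.mono ω k.le_succ
  have htel : ∑ t ∈ Finset.Ico (τ k ω) (τ (k + 1) ω),
      (β k ω (X (t + 1) ω) - β k ω (X t ω)) ≤ D := by
    rw [Finset.sum_Ico_sub (fun t => β k ω (X t ω)) hτk]
    exact (sub_le_span _ _ _).trans (hspan k hk)
  -- Replacing the phase's `D` by its telescoping sum reduces the claim to a comparison round by
  -- round.
  refine le_trans ?_ (add_le_add_left (add_le_add_right htel _) _)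
  rw [← Finset.sum_add_distrib, ← Finset.sum_add_distrib, ← Finset.sum_add_distrib]
  refine Finset.sum_le_sum fun t ht => ?_
  have hopt := hpolicy k hk t ht
  have hρ := (hdual k hk).optGain_le (hω k hk)
  have hact := h.act_eq ω k hk t ht
  obtain ⟨h1, h2⟩ := Finset.mem_Ico.1 ht
  simp only [truncatedDual_eq (h.mono ω) h1 h2 (hspan k hk), hact, ConfModel.CP, sub_mul,
    Finset.sum_sub_distrib]
  rw [ConfModel.OptimalAction] at hopt
  linarith

/-- By the decomposition, the bound can fail on the good event only if the noise exceeds `D * √(T *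
L)`. -/
theorem IsPhasedRun.measure_regret_gt_le [Fintype A] [IsProbabilityMeasure μ]
    (h : IsPhasedRun μ ℱ M T X act τ m π β) {C : ℕ → Ω → ConfModel S A I} {ρ : ℕ → Ω → ℝ} {D : ℝ}
    (hdual : ∀ ω ∈ goodEvent M C m, ∀ k < m ω, (C k ω).DualFeasible M.r (β k ω) (ρ k ω))
    (hpolicy : ∀ ω ∈ goodEvent M C m, ∀ k < m ω, ∀ t ∈ Finset.Ico (τ k ω) (τ (k + 1) ω),
      (C k ω).OptimalAction M.r (β k ω) (ρ k ω) (X t ω) (π k ω (X t ω)))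
    (hspan : ∀ ω ∈ goodEvent M C m, ∀ k < m ω, span (β k ω) ≤ D) {L : ℝ} (hL : 0 ≤ L) :
    μ {ω | ω ∈ goodEvent M C m ∧ ¬ (regret M T X act ω ≤
        phaseSum X τ m π (fun k ω => (C k ω).CB (β k ω)) ω
        + phaseSum X τ m π (fun k ω => (C k ω).CP M.P (β k ω)) ω + D * m ω + D * √(T * L))}
      ≤ ENNReal.ofReal (Real.exp (-(2 * L))) := by
  have hreg := fun ω hω => h.regret_le hω (hdual ω hω) (hpolicy ω hω) (hspan ω hω)
  rcases lt_or_ge D 0 with hD | hD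
  · -- a negative bound on the span leaves room for no phase, hence for no round
    refine (measure_mono (t := ∅) ?_).trans (by simp)
    rintro ω ⟨hω, hfail⟩
    have hm : m ω = 0 := by
      by_contra hm
      exact absurd ((span_nonneg _).trans (hspan ω hω 0 (Nat.pos_of_ne_zero hm))) (not_le.2 hD)
    have hT : T = 0 := by rw [← h.finish ω, hm, h.start ω]
    have := hreg ω hω
    subst hT
    simp only [noiseSum, Finset.range_zero, Finset.sum_empty] at this
    exact hfail (by simpa using this)
  · refine (measure_mono ?_).trans (measure_noiseSum_gt_le
      (p := fun t ω => M.P (X t ω) (act t ω)) (b := truncatedDual τ β D) h.state_adapted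
      (fun t ht y => h.measurable_transition ht y)
      (fun t ht y => h.measurable_truncatedDual D ht y)
      (fun t ω y => M.isTransition.1 _ _ _) (fun t ω => M.isTransition.2 _ _)
      (truncatedDual_sub_le τ β hD) h.transition hD hL)
    rintro ω ⟨hω, hfail⟩
    have := hreg ω hω
    change D * √(T * L) < noiseSum _ _ X T ω
    linarith [not_le.1 hfail]

end Phases

end AvgReward

/-! ### The two choices of L -/

theorem mainTheorem10 {S A I Ω : Type*} [Fintype S] [DecidableEq S] [Nonempty S]
    [Fintype A] [Nonempty A] [Fintype I] {mΩ : MeasurableSpace Ω}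
    (μ : MeasureTheory.Measure Ω) [MeasureTheory.IsProbabilityMeasure μ]
    (ℱ : MeasureTheory.Filtration ℕ mΩ) (M : AvgReward.MDP S A) (T : ℕ)
    (X : ℕ → Ω → S) (act : ℕ → Ω → A) (τ : ℕ → Ω → ℕ) (m : Ω → ℕ)
    (π : ℕ → Ω → S → A) (C : ℕ → Ω → AvgReward.ConfModel S A I)
    (β : ℕ → Ω → S → ℝ) (ρ : ℕ → Ω → ℝ) (D : ℝ)
    (hrun : AvgReward.IsPhasedRun μ ℱ M T X act τ m π β)
    -- `(β k, ρ k)` is an optimal solution of the dual program of phase `k`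
    (hdual : ∀ ω ∈ AvgReward.goodEvent M C m, ∀ k < m ω,
      (C k ω).DualOptimal M.r (β k ω) (ρ k ω))
    -- the policy `π k` satisfies the optimality equation in the states visited in phase `k`
    (hpolicy : ∀ ω ∈ AvgReward.goodEvent M C m, ∀ k < m ω,
      ∀ t ∈ Finset.Ico (τ k ω) (τ (k + 1) ω),
        (C k ω).OptimalAction M.r (β k ω) (ρ k ω) (X t ω) (π k ω (X t ω)))
    (hspan : ∀ ω ∈ AvgReward.goodEvent M C m, ∀ k < m ω, AvgReward.span (β k ω) ≤ D) :
    (∀ δ : ℝ, 1 ≤ 2 * δ * (T : ℝ) ^ 2 →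
      μ {ω | ω ∈ AvgReward.goodEvent M C m ∧
        ¬ (AvgReward.regret M T X act ω ≤
            AvgReward.phaseSum X τ m π (fun k ω => (C k ω).CB (β k ω)) ω
            + AvgReward.phaseSum X τ m π (fun k ω => (C k ω).CP M.P (β k ω)) ω
            + D * m ω + D * √(T * Real.log T))} ≤ ENNReal.ofReal (2 * δ)) ∧
    (∀ δ : ℝ, 0 < δ → δ < 1 →
      μ {ω | ω ∈ AvgReward.goodEvent M C m ∧
        ¬ (AvgReward.regret M T X act ω ≤
            AvgReward.phaseSum X τ m π (fun k ω => (C k ω).CB (β k ω)) ω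
            + AvgReward.phaseSum X τ m π (fun k ω => (C k ω).CP M.P (β k ω)) ω
            + D * m ω + D * √(T * Real.log (1 / δ)))} ≤ ENNReal.ofReal (2 * δ)) := by
  have hfeas : ∀ ω ∈ AvgReward.goodEvent M C m, ∀ k < m ω,
      (C k ω).DualFeasible M.r (β k ω) (ρ k ω) := fun ω hω k hk => (hdual ω hω k hk).1
  refine ⟨fun δ hδ => ?_, fun δ hδ0 hδ1 => ?_⟩
  · have hT : T ≠ 0 := by
      rintro rfl
      norm_num at hδ
    have hTpos : (0 : ℝ) < T := by exact_mod_cast Nat.pos_of_ne_zero hT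
    refine (hrun.measure_regret_gt_le hfeas hpolicy hspan (Real.log_natCast_nonneg T)).trans
      (ENNReal.ofReal_le_ofReal ?_)
    -- The tail is T⁻², which is at most 2δ exactly by the hypothesis on `δ`.
    have hexp : Real.exp (-(2 * Real.log T)) = ((T : ℝ) ^ 2)⁻¹ := by
      rw [Real.exp_neg, two_mul, Real.exp_add, Real.exp_log hTpos, sq]
    rw [hexp, inv_le_iff_one_le_mul₀ (by positivity)]
    exact hδ
  · have hL : 0 ≤ Real.log (1 / δ) :=
      Real.log_nonneg ((one_le_div hδ0).2 hδ1.le)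
    refine (hrun.measure_regret_gt_le hfeas hpolicy hspan hL).trans
      (ENNReal.ofReal_le_ofReal ?_)
    -- The tail is δ², below 2δ because δ < 1.
    have hexp : Real.exp (-(2 * Real.log (1 / δ))) = δ * δ := by
      rw [one_div, Real.log_inv, mul_neg, neg_neg, two_mul, Real.exp_add, Real.exp_log hδ0]
    rw [hexp]
    nlinarith
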